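/- Let $M$ be an $n$-dimensional $\mathcal C^2$-manifold embedded in $\mathbb R^{n+k}$ by a $\mathcal C^2$-embedding (below, $M$ is identified with its image). Let $a\colon TM\to\mathbb R^{n+k}$, $a(v_p)=p+v_p$, take a tangent vector to the corresponding point of the affine tangent plane. Let $\phi\colon TM\to M$ be any map such that $\|\phi(v_p)-a(v_p)\|=\min_{q\in M}\|q-a(v_p)\|$ for every $v_p\in TM$ for which the minimum exists (Euclidean norm). (1) Then $\phi$ and $\psi=\phi$ satisfy conditions C1--C2, that is: for every $p\in M$ there are a $\mathcal C^2$-chart $(U,\varphi)$ of $M$ with $\varphi(p)=0$ and a $\rho>0$ such that, writing $\tau_\varphi$ for the chart of $TM$ induced by $\varphi$ and $\widehat\phi_x(y)=\varphi\circ\phi\circ\tau_\varphi^{-1}(x,y)$ and $\widehat\psi_x(y)=\varphi\circ\psi\circ\tau_\varphi^{-1}(x,y)$ for the (partially defined) local representations of $\phi$ and $\psi$: C1: for every $x\in B(0;\rho)$, $\widehat\phi_x$ is defined near $0$, $\widehat\phi_x(0)=x$, $D\widehat\phi_x(0)=I$, and $D^2\widehat\phi_x(0)$ exists; and there is $\alpha\in\mathbb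 R$ with $\|D^2\widehat\phi_x(0)\cdot(\xi,\xi)\|\le\alpha$ for all $x\in B(0;\rho)$ and all $\|\xi\|=1$; C2: $\widehat\psi_x(y)$ is defined for all $x,y\in B(0;\rho)$, and there is $\beta\in\mathbb R$ with $\|\widehat\psi_x(y)-x-y\|\le\beta\|y\|^2$ for all such $x,y$. (2) Consequently, let $f\colon M\to\mathbb R$ be $\mathcal C^2$ and let $p^*\in M$ be a non-degenerate critical point of $f$ (that is, $Df(p^*)=0$ and the Hessian of $f$ at $p^*$ is invertible). Assume that for some $\mathcal C^2$-chart $(U,\varphi)$ with $\varphi(p^*)=0$ and some $\eta>0$, the function $\widehat f=f\circ\varphi^{-1}$ satisfies $\|[\operatorname{Hess}_{\widehat f}(x)-\operatorname{Hess}_{\widehat f}(0)]\,x\|\le\eta\|x\|^2$ for all $x\in\varphi(U)$. Then the projection-based Newton iteration $$E_f(p)=\phi_p\bigl(N_{f\circ\phi_p}(0_p)\bigr),\qquad N_g(v)=v-[D^2g(v)]^{-1}Dg(v),$$ where $\phi_p=\phi|_{T_pM}$, converges locally quadratically to $p^*$: there are a $\mathcal C^2$-chart $\varphi'$ around $p^*$,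 a constant $\kappa$ and an open set $V\ni\varphi'(p^*)$ in $\mathbb R^n$ such that $N=\varphi'\circ E_f\circ\varphi'^{-1}$ is defined on $V$, $N(V)\subset V$, and $\|N(x)-\varphi'(p^*)\|\le\kappa\|x-\varphi'(p^*)\|^2$ for all $x\in V$. -/

import Mathlib

open Set Filter Topology Metric
open scoped Manifold ContDiff

noncomputable section

namespace NewtonMfd

/-- `ℝᵐ` with the Euclidean norm. -/
abbrev Euc (m : ℕ) : Type := EuclideanSpace ℝ (Fin m)

/-- `g` is differentiable near `x` and its derivative is differentiable at `x`,
that is, the second derivative `D²g(x)` exists. -/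
def TwiceDifferentiableAt {V W : Type*} [NormedAddCommGroup V] [NormedSpace ℝ V]
    [NormedAddCommGroup W] [NormedSpace ℝ W] (g : V → W) (x : V) : Prop :=
  (∀ᶠ y in 𝓝 x, DifferentiableAt ℝ g y) ∧ DifferentiableAt ℝ (fderiv ℝ g) x

/-- The second derivative of `g` at `x`; for real-valued `g`, this is the Hessian, as a linear map
from `V` to its dual. -/
def secondDeriv {V W : Type*} [NormedAddCommGroup V] [NormedSpace ℝ V]
    [NormedAddCommGroup W] [NormedSpace ℝ W] (g : V → W) (x : V) : V →L[ℝ] V →L[ℝ] W :=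
  fderiv ℝ (fderiv ℝ g) x

section Local

variable {n : ℕ}

/-! A partially defined function `h : ℝⁿ × ℝⁿ → ℝⁿ` is given by its domain of definition `dom`
and a total function whose values outside `dom` are irrelevant. -/

/-- `H1`: `h_x(0) = x` and `Dh_x(0) = I` for `‖x‖ < ρ`. -/
def H1 (dom : Set (Euc n × Euc n)) (h : Euc n → Euc n → Euc n) (ρ : ℝ) : Prop :=
  ∀ x ∈ ball (0 : Euc n) ρ, (∀ᶠ y in 𝓝 (0 : Euc n), (x, y) ∈ dom) ∧
    h x 0 = x ∧ HasFDerivAt (h x) (ContinuousLinearMap.id ℝ (Euc n)) 0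

/-- `H2`: `D²h_x(0)` exists and is bounded uniformly in `‖x‖ < ρ`, with respect to the norm
`sup_{‖η‖ = 1} ‖D²h_x(0)·(η, η)‖`. -/
def H2 (dom : Set (Euc n × Euc n)) (h : Euc n → Euc n → Euc n) (ρ : ℝ) : Prop :=
  ∃ α : ℝ, ∀ x ∈ ball (0 : Euc n) ρ, (∀ᶠ y in 𝓝 (0 : Euc n), (x, y) ∈ dom) ∧
    TwiceDifferentiableAt (h x) 0 ∧
    ∀ η : Euc n, ‖η‖ = 1 → ‖secondDeriv (h x) 0 η η‖ ≤ α

/-- `H3`: `‖h_x(y) - x - y‖ ≤ β ‖y‖²` for `‖x‖, ‖y‖ < ρ`. -/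
def H3 (dom : Set (Euc n × Euc n)) (h : Euc n → Euc n → Euc n) (ρ : ℝ) : Prop :=
  ∃ β : ℝ, ∀ x ∈ ball (0 : Euc n) ρ, ∀ y ∈ ball (0 : Euc n) ρ,
    (x, y) ∈ dom ∧ ‖h x y - x - y‖ ≤ β * ‖y‖ ^ 2

end Local

section Manifold

variable {n : ℕ} {M : Type*} [TopologicalSpace M] [ChartedSpace (Euc n) M]

/-- The inverse of the chart of `TM` induced by the chart `c` of `M`: it sends `(x, η)` to
the tangent vector at `c⁻¹(x)` with components `η` in the coordinate frame of `c`. -/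
def tangentChartInv (c : OpenPartialHomeomorph M (Euc n)) (x y : Euc n) :
    TangentBundle (𝓡 n) M :=
  ⟨c.symm x, mfderiv (𝓡 n) (𝓡 n) c.symm x y⟩

/-- The representation `c ∘ φ ∘ τ_c⁻¹` of `φ : TM → M` in the chart `c`. -/
def localRep (c : OpenPartialHomeomorph M (Euc n)) (φ : TangentBundle (𝓡 n) M → M)
    (x y : Euc n) : Euc n :=
  c (φ (tangentChartInv c x y))

/-- The domain of definition of `c ∘ φ ∘ τ_c⁻¹`. -/
def localDom (c : OpenPartialHomeomorph M (Euc n)) (φ : TangentBundle (𝓡 n) M → M) :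
    Set (Euc n × Euc n) :=
  {z | z.1 ∈ c.target ∧ φ (tangentChartInv c z.1 z.2) ∈ c.source}

/-- Conditions C1 (on `φ`) and C2 (on `ψ`). -/
def SatisfiesC1C2 (φ ψ : TangentBundle (𝓡 n) M → M) : Prop :=
  ∀ p : M, ∃ c ∈ IsManifold.maximalAtlas (𝓡 n) 2 M, p ∈ c.source ∧ c p = 0 ∧ ∃ ρ > 0,
    (H1 (localDom c φ) (localRep c φ) ρ ∧ H2 (localDom c φ) (localRep c φ) ρ) ∧
    H3 (localDom c ψ) (localRep c ψ) ρ

/-- The point of the affine tangent plane of `ι(M)` at `ι(p)` corresponding to `v ∈ T_pM`. -/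
def affinePoint {m : ℕ} (ι : M → Euc m) (v : TangentBundle (𝓡 n) M) : Euc m :=
  let w : Euc m := mfderiv (𝓡 n) (𝓡 m) ι v.proj v.snd
  ι v.proj + w

/-- `φ(v)` is a point of `M` nearest to the point of the affine tangent plane given by `v`,
for every `v` for which a nearest point exists. -/
def IsProjectionParametrisation {m : ℕ} (ι : M → Euc m) (φ : TangentBundle (𝓡 n) M → M) : Prop :=
  ∀ v : TangentBundle (𝓡 n) M,
    (∃ q : M, ∀ r : M, ‖ι q - affinePoint ι v‖ ≤ ‖ι r - affinePoint ι v‖) →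
      ∀ r : M, ‖ι (φ v) - affinePoint ι v‖ ≤ ‖ι r - affinePoint ι v‖

/-- The Newton iteration function `N_g(x) = x - [D²g(x)]⁻¹ Dg(x)`. It is meaningful only where
`NewtonDefinedAt g x` holds. -/
def newtonStep {V : Type*} [NormedAddCommGroup V] [NormedSpace ℝ V] (g : V → ℝ) (x : V) : V :=
  x - (secondDeriv g x).inverse (fderiv ℝ g x)

/-- The Newton step of `g` at `x` is defined: the Hessian exists and is invertible. -/
def NewtonDefinedAt {V : Type*} [NormedAddCommGroup V] [NormedSpace ℝ V] (g : V → ℝ) (x : V) :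
    Prop :=
  TwiceDifferentiableAt g x ∧ (secondDeriv g x).IsInvertible

/-- The restriction `φ_p : T_pM → M` of `φ`. The space `T_pM` is, by definition, `ℝⁿ` (through the
preferred chart at `p`). -/
def fibreMap (φ : TangentBundle (𝓡 n) M → M) (p : M) (v : Euc n) : M :=
  φ ⟨p, v⟩

/-- The generalised Newton iteration function `E_f(p) = ψ_p (N_{f ∘ φ_p}(0_p))`. -/
def newtonIteration (φ ψ : TangentBundle (𝓡 n) M → M) (f : M → ℝ) (p : M) : M :=
  fibreMap ψ p (newtonStep (f ∘ fibreMap φ p) 0)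

/-- The set of points at which the generalised Newton iteration function is defined. -/
def newtonDom (φ : TangentBundle (𝓡 n) M → M) (f : M → ℝ) : Set M :=
  {p | NewtonDefinedAt (f ∘ fibreMap φ p) 0}

/-- `p` is a critical point of `f`, non-degenerate in the chart `c`. (At a critical point, this
does not depend on `c`.) -/
def IsNondegenerateCriticalPoint (c : OpenPartialHomeomorph M (Euc n)) (f : M → ℝ) (p : M) : Prop :=
  mfderiv (𝓡 n) 𝓘(ℝ, ℝ) f p = 0 ∧ (secondDeriv (f ∘ c.symm) (c p)).IsInvertible

/-- The iteration function `E`, defined on `D ⊆ M`, converges locally quadratically to `p`: in some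
chart `c` there are a constant `κ` and an open set `U` around `c(p)` on which `c ∘ E ∘ c⁻¹` is
defined, which it maps to itself, and on which it satisfies the quadratic bound. -/
def ConvergesLocallyQuadratically (D : Set M) (E : M → M) (p : M) : Prop :=
  ∃ c ∈ IsManifold.maximalAtlas (𝓡 n) 2 M, p ∈ c.source ∧
    ∃ (κ : ℝ) (U : Set (Euc n)), IsOpen U ∧ c p ∈ U ∧
      ∀ x ∈ U, (x ∈ c.target ∧ c.symm x ∈ D ∧ E (c.symm x) ∈ c.source) ∧
        c (E (c.symm x)) ∈ U ∧ ‖c (E (c.symm x)) - c p‖ ≤ κ * ‖x - c p‖ ^ 2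

end Manifold

end NewtonMfd

end

/-! In a chart `c`, put `g = ι ∘ c.symm`. Near `p` a nearest point of the manifold exists, lies in
the chart because `ι` is an embedding, and solves the normal equation `⟪g z - a, Dg(z) ·⟫ = 0`. Its
derivative in `z` at a point of the image is the Gram form of `Dg`, invertible for an immersion, so
the implicit function theorem gives a local solution `z = π a`, and `φ` reads `h x y = π (g x +
Dg(x) y)`.

Since `g` is only C², `π` is only C¹, yet `h x` must have a second derivative at `0`.
Differentiating the normal equation gives `Dπ(a) = Q (π a)` up to a multiple of the residual `g (π
a) - a`, where `Q`, the pseudoinverse of `Dg`, is C¹. Along the affine tangent plane at `g x` the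
residual is `o(‖y‖)`, so `y ↦ Dπ(g x + Dg(x) y)` is differentiable at `0` with derivative `DQ(x)`.
Hence `D²h_x(0)` is `DQ(x)` followed by composition with `Dg(x)`, and is bounded near `c p`
(`exists_projection`, `exists_isParametrisationFamily`). C2 follows from `π (g (x + y)) = x + y`,
Taylor's formula for `g` and a Lipschitz bound for `π`.

For convergence, with `F = f ∘ c.symm`, the Hessian `J x` of `F ∘ h x` at `0` is `D²F(x)` plus a
term `DF(x) ∘ D²h_x(0)` of size `O(‖x‖)`, as `DF(0) = 0`. Thus the Newton step is `-x + O(‖x‖²)`,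
and C2 transfers this to the new iterate (`exists_newton_quadratic_bound`). -/

noncomputable section

namespace NewtonMfd

/-! ### The normal equation and its C¹ solution -/

section NearestPoint

set_option maxSynthPendingDepth 3

variable {E F : Type*} [NormedAddCommGroup E] [InnerProductSpace ℝ E]
  [NormedAddCommGroup F] [InnerProductSpace ℝ F]

/-- The map `L ↦ (b ↦ ⟪b, L ·⟫)`, sending a linear map to its transpose. -/
def transposeL (E F : Type*) [NormedAddCommGroup E] [InnerProductSpace ℝ E]
    [NormedAddCommGroup F] [InnerProductSpace ℝ F] :
    (E →L[ℝ] F) →L[ℝ] F →L[ℝ] E →L[ℝ] ℝ :=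
  ((ContinuousLinearMap.compL ℝ F (F →L[ℝ] ℝ) (E →L[ℝ] ℝ)).flip (innerSL ℝ)).comp
    (ContinuousLinearMap.compL ℝ E F ℝ).flip

@[simp]
theorem transposeL_apply (L : E →L[ℝ] F) (b : F) (η : E) :
    transposeL E F L b η = inner ℝ b (L η) := rfl

theorem contDiff_transposeL {r : ℕ∞ω} :
    ContDiff ℝ r (transposeL E F : (E →L[ℝ] F) → F →L[ℝ] E →L[ℝ] ℝ) :=
  (transposeL E F).contDiff

/-- Evaluated twice at `ξ`, the Gram form gives `‖L ξ‖ ^ 2`, so its kernel is trivial; `E` and its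
dual have the same dimension. -/
theorem isInvertible_transposeL_comp [FiniteDimensional ℝ E] {L : E →L[ℝ] F}
    (hL : Function.Injective L) : ((transposeL E F L).comp L).IsInvertible := by
  have hinj : Function.Injective ((transposeL E F L).comp L : E →ₗ[ℝ] (E →L[ℝ] ℝ)) := by
    rw [← LinearMap.ker_eq_bot, LinearMap.ker_eq_bot']
    intro ξ hξ
    have h := congrArg (fun A : E →L[ℝ] ℝ => A ξ) hξ
    apply hL
    simpa using h
  have hd : Module.finrank ℝ E = Module.finrank ℝ (E →L[ℝ] ℝ) :=
    (InnerProductSpace.toDual ℝ E).toLinearEquiv.finrank_eq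
  exact ⟨(LinearEquiv.ofInjectiveOfFinrankEq _ hinj hd).toContinuousLinearEquiv, by ext; rfl⟩

/-- `(a, z) ↦ ⟪g z - a, Dg(z) ·⟫`, half the derivative of `‖g z - a‖ ^ 2` in `z`. -/
def normalEq (g : E → F) (v : F × E) : E →L[ℝ] ℝ :=
  transposeL E F (fderiv ℝ g v.2) (g v.2 - v.1)

theorem normalEq_self (g : E → F) (z : E) : normalEq g (g z, z) = 0 := by
  simp [normalEq]

theorem contDiffAt_normalEq {g : E → F} {v : F × E} (hg : ContDiffAt ℝ 2 g v.2) :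
    ContDiffAt ℝ 1 (normalEq g) v := by
  have h1 : ContDiffAt ℝ 1 (fderiv ℝ g) v.2 := hg.fderiv_right (by norm_num)
  have h2 : ContDiffAt ℝ 1 (fun v : F × E => fderiv ℝ g v.2) v := h1.comp v contDiffAt_snd
  have h3 : ContDiffAt ℝ 1 (fun v : F × E => g v.2) v :=
    (hg.of_le (by norm_num)).comp v contDiffAt_snd
  exact (ContDiffAt.comp v (g := transposeL E F) contDiff_transposeL.contDiffAt h2).clm_apply (h3.sub contDiffAt_fst)

/-- The first summand carries the second derivative of `g` and is linear in the residual, so it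
vanishes on the image of `g`. -/
theorem hasFDerivAt_normalEq {g : E → F} {v : F × E} (hg : ContDiffAt ℝ 2 g v.2) :
    HasFDerivAt (normalEq g)
      (((transposeL E F).flip (g v.2 - v.1)).comp
          ((fderiv ℝ (fderiv ℝ g) v.2).comp (.snd ℝ F E)) +
        (transposeL E F (fderiv ℝ g v.2)).comp
          ((fderiv ℝ g v.2).comp (.snd ℝ F E) - .fst ℝ F E)) v := by
  have h1 : ContDiffAt ℝ 1 (fderiv ℝ g) v.2 := hg.fderiv_right (by norm_num)
  have h2 : HasFDerivAt (fun v : F × E => fderiv ℝ g v.2) _ v :=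
    (h1.differentiableAt (by norm_num)).hasFDerivAt.comp v hasFDerivAt_snd
  have h3 : HasFDerivAt (fun v : F × E => g v.2 - v.1) _ v :=
    ((hg.differentiableAt (by norm_num)).hasFDerivAt.comp v hasFDerivAt_snd).sub hasFDerivAt_fst
  have h5 : HasFDerivAt (transposeL E F : (E →L[ℝ] F) → F →L[ℝ] E →L[ℝ] ℝ) (transposeL E F)
      (fderiv ℝ g v.2) := (transposeL E F).hasFDerivAt
  have h4 := (HasFDerivAt.comp v h5 h2).clm_apply h3
  refine h4.congr_fderiv ?_
  rw [add_comm]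
  congr 1

/-- The nearest point projection onto the image of an immersion `g`: it solves the normal equation
and is `C¹`, and its derivative is, up to an error controlled by the distance to the image,
a `C¹` function of the projected point. -/
theorem exists_projection [FiniteDimensional ℝ E] [CompleteSpace F] {g : E → F} {x₀ : E}
    (hg : ContDiffAt ℝ 2 g x₀) (hinj : Function.Injective (fderiv ℝ g x₀)) :
    ∃ (π : F → E) (Q : E → F →L[ℝ] E) (C : ℝ),
      ContDiffAt ℝ 1 π (g x₀) ∧ ContDiffAt ℝ 1 Q x₀ ∧
      (∀ᶠ v in 𝓝 (g x₀, x₀), normalEq g v = 0 ↔ π v.1 = v.2) ∧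
      ∀ᶠ a in 𝓝 (g x₀), ‖fderiv ℝ π a - Q (π a)‖ ≤ C * ‖g (π a) - a‖ := by
  have : CompleteSpace E := FiniteDimensional.complete ℝ E
  set A : E → E →L[ℝ] E →L[ℝ] ℝ :=
    fun z => (transposeL E F (fderiv ℝ g z)).comp (fderiv ℝ g z) with hA
  have hA0 : (A x₀).IsInvertible := isInvertible_transposeL_comp hinj
  have cdf : ContDiffAt ℝ 1 (normalEq g) (g x₀, x₀) := contDiffAt_normalEq hg
  have hd0 : fderiv ℝ (normalEq g) (g x₀, x₀) ∘L .inr ℝ F E = A x₀ := by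
    rw [(hasFDerivAt_normalEq (v := (g x₀, x₀)) hg).fderiv]
    ext; simp [hA]
  have if₂ : (fderiv ℝ (normalEq g) (g x₀, x₀) ∘L .inr ℝ F E).IsInvertible := hd0 ▸ hA0
  set π := cdf.implicitFunction one_ne_zero if₂ with hπ
  have hπ1 : ContDiffAt ℝ 1 π (g x₀) := cdf.contDiffAt_implicitFunction one_ne_zero if₂
  have hπ0 : π (g x₀) = x₀ := cdf.implicitFunction_apply_self one_ne_zero if₂
  have hDg : ContDiffAt ℝ 1 (fderiv ℝ g) x₀ := hg.fderiv_right (by norm_num)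
  have hB1 : ContDiffAt ℝ 1 (fun z => transposeL E F (fderiv ℝ g z)) x₀ :=
    ContDiffAt.comp x₀ (g := transposeL E F) contDiff_transposeL.contDiffAt hDg
  have hA1 : ContDiffAt ℝ 1 A x₀ := hB1.clm_comp hDg
  have hAi : ContDiffAt ℝ 1 (fun z => (A z).inverse) x₀ :=
    (hA0.contDiffAt_map_inverse (n := 1)).comp x₀ hA1
  set Q : E → F →L[ℝ] E := fun z => (A z).inverse.comp (transposeL E F (fderiv ℝ g z)) with hQ
  have hπc : Tendsto π (𝓝 (g x₀)) (𝓝 x₀) := by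
    simpa [hπ0] using hπ1.continuousAt.tendsto
  -- The coefficient of the residual in `Dπ - Q ∘ π`; continuity bounds it near `g x₀` by `W (g x₀)
  -- + 1`.
  set W : F → ℝ := fun a => ‖(A (π a)).inverse‖ * (‖transposeL E F‖ *
    (‖fderiv ℝ (fderiv ℝ g) (π a)‖ * ‖fderiv ℝ π a‖)) with hW
  have hWc : ContinuousAt W (g x₀) := by
    have e1 : ContinuousAt (fun a => (A (π a)).inverse) (g x₀) :=
      ContinuousAt.comp (g := fun z => (A z).inverse) (by rw [hπ0]; exact hAi.continuousAt)
        hπ1.continuousAt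
    have e2 : ContinuousAt (fun a => fderiv ℝ (fderiv ℝ g) (π a)) (g x₀) :=
      ContinuousAt.comp (g := fun z => fderiv ℝ (fderiv ℝ g) z)
        (by rw [hπ0]; exact (hDg.fderiv_right (m := 0) (by norm_num)).continuousAt)
        hπ1.continuousAt
    have e3 : ContinuousAt (fderiv ℝ π) (g x₀) :=
      (hπ1.fderiv_right (m := 0) (by norm_num)).continuousAt
    exact e1.norm.mul (continuousAt_const.mul (e2.norm.mul e3.norm))
  refine ⟨π, Q, W (g x₀) + 1, hπ1, hAi.clm_comp hB1, ?_, ?_⟩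
  · filter_upwards [cdf.eventually_apply_eq_iff_implicitFunction one_ne_zero if₂] with v hv
    rw [← hv, normalEq_self]
  · have i1 : ∀ᶠ a in 𝓝 (g x₀), ContDiffAt ℝ 2 g (π a) :=
      hπc.eventually (hg.eventually (by simp))
    have i2 : ∀ᶠ a in 𝓝 (g x₀), ContDiffAt ℝ 1 π a := hπ1.eventually (by simp)
    -- The equation is needed on a neighbourhood of each `a`, so that it can be differentiated
    -- there.
    have i3 : ∀ᶠ a in 𝓝 (g x₀), ∀ᶠ b in 𝓝 a, normalEq g (b, π b) = 0 := by
      refine Filter.Eventually.eventually_nhds ?_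
      filter_upwards [cdf.eventually_apply_implicitFunction one_ne_zero if₂] with a ha
      rw [ha, normalEq_self]
    have i4 : ∀ᶠ a in 𝓝 (g x₀), W a < W (g x₀) + 1 := hWc.eventually_lt_const (by linarith)
    have i5 : ∀ᶠ a in 𝓝 (g x₀), (A (π a)).IsInvertible := by
      refine hπc.eventually (p := fun z => (A z).IsInvertible) ?_
      obtain ⟨e, he⟩ := hA0
      have := (ContinuousLinearEquiv.nhds e)
      rw [he] at this
      filter_upwards [hA1.continuousAt.tendsto this] with z hz
      exact hz
    filter_upwards [i1, i2, i3, i4, i5] with a h1 h2 h3 h4 h5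
    have hdπ := (h2.differentiableAt (by norm_num)).hasFDerivAt
    have hcomp := (hasFDerivAt_normalEq (v := (a, π a)) h1).comp a
      ((hasFDerivAt_id a).prodMk hdπ)
    have hzero := hcomp.unique ((hasFDerivAt_const (0 : E →L[ℝ] ℝ) a).congr_of_eventuallyEq h3)
    have key : fderiv ℝ π a - Q (π a) = - (A (π a)).inverse.comp
        (((transposeL E F).flip (g (π a) - a)).comp
          ((fderiv ℝ (fderiv ℝ g) (π a)).comp (fderiv ℝ π a))) := by
      ext1 b
      have hb := congrArg (fun T : F →L[ℝ] E →L[ℝ] ℝ => T b) hzero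
      obtain ⟨e, he⟩ := h5
      have hAe : A (π a) (fderiv ℝ π a b) = transposeL E F (fderiv ℝ g (π a)) b -
          transposeL E F (fderiv ℝ (fderiv ℝ g) (π a) (fderiv ℝ π a b)) (g (π a) - a) := by
        simp only [ContinuousLinearMap.comp_apply, ContinuousLinearMap.prod_apply, add_apply,
          sub_apply, ContinuousLinearMap.flip_apply, ContinuousLinearMap.coe_fst',
          ContinuousLinearMap.coe_snd', ContinuousLinearMap.coe_id', id_eq, zero_apply,
          map_sub (transposeL E F (fderiv ℝ g (π a)))] at hb
        simp only [hA, ContinuousLinearMap.comp_apply]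
        rw [← sub_eq_zero, ← hb]
        abel
      have : fderiv ℝ π a b = (A (π a)).inverse (A (π a) (fderiv ℝ π a b)) := by
        rw [← he]; simp
      simp only [hQ, sub_apply, ContinuousLinearMap.comp_apply,
        neg_apply, ContinuousLinearMap.flip_apply]
      nth_rw 1 [this, hAe]
      rw [map_sub]
      abel
    rw [key, norm_neg]
    calc _ ≤ ‖(A (π a)).inverse‖ * ((‖transposeL E F‖ * ‖g (π a) - a‖) *
          (‖fderiv ℝ (fderiv ℝ g) (π a)‖ * ‖fderiv ℝ π a‖)) := by
          refine (ContinuousLinearMap.opNorm_comp_le _ _).trans ?_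
          gcongr
          refine (ContinuousLinearMap.opNorm_comp_le _ _).trans ?_
          gcongr
          · refine (ContinuousLinearMap.le_opNorm _ _).trans ?_
            rw [ContinuousLinearMap.opNorm_flip]
          · exact ContinuousLinearMap.opNorm_comp_le _ _
      _ = W a * ‖g (π a) - a‖ := by simp only [hW]; ring
      _ ≤ _ := by gcongr

end NearestPoint

/-! ### C1 and C2 for the local projection -/

section LocalProjection

set_option maxSynthPendingDepth 3

variable {E F : Type*} [NormedAddCommGroup E] [InnerProductSpace ℝ E]
  [NormedAddCommGroup F] [InnerProductSpace ℝ F]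

/-- On `B(x₀; ρ)`, the family `h` satisfies the estimates of `H1`, `H2` and `H3`, the second
derivative being bounded in operator norm. -/
structure IsParametrisationFamily {E : Type*} [NormedAddCommGroup E] [NormedSpace ℝ E]
    (h : E → E → E) (x₀ : E) (ρ α β : ℝ) : Prop where
  apply_zero : ∀ x ∈ ball x₀ ρ, h x 0 = x
  hasFDerivAt : ∀ x ∈ ball x₀ ρ, HasFDerivAt (h x) (ContinuousLinearMap.id ℝ E) 0
  twiceDifferentiableAt : ∀ x ∈ ball x₀ ρ, TwiceDifferentiableAt (h x) 0
  norm_secondDeriv_le : ∀ x ∈ ball x₀ ρ, ‖secondDeriv (h x) 0‖ ≤ α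
  norm_sub_le : ∀ x ∈ ball x₀ ρ, ∀ y ∈ ball (0 : E) ρ, ‖h x y - x - y‖ ≤ β * ‖y‖ ^ 2

theorem IsParametrisationFamily.mono {E : Type*} [NormedAddCommGroup E] [NormedSpace ℝ E]
    {h : E → E → E} {x₀ : E} {ρ ρ' α β : ℝ} (H : IsParametrisationFamily h x₀ ρ α β)
    (hρ : ρ' ≤ ρ) : IsParametrisationFamily h x₀ ρ' α β where
  apply_zero x hx := H.apply_zero x (ball_subset_ball hρ hx)
  hasFDerivAt x hx := H.hasFDerivAt x (ball_subset_ball hρ hx)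
  twiceDifferentiableAt x hx := H.twiceDifferentiableAt x (ball_subset_ball hρ hx)
  norm_secondDeriv_le x hx := H.norm_secondDeriv_le x (ball_subset_ball hρ hx)
  norm_sub_le x hx y hy := H.norm_sub_le x (ball_subset_ball hρ hx) y (ball_subset_ball hρ hy)

/-- Second order Taylor estimate, uniform in the base point. -/
theorem exists_norm_taylor_le {V W : Type*} [NormedAddCommGroup V] [NormedSpace ℝ V]
    [NormedAddCommGroup W] [NormedSpace ℝ W] {g : V → W} {x₀ : V}
    (hg : ContDiffAt ℝ 2 g x₀) : ∃ K : ℝ, 0 ≤ K ∧ ∃ r > 0, ∀ x ∈ ball x₀ r, ∀ y ∈ ball (0 : V) r,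
      ‖g (x + y) - g x - fderiv ℝ g x y‖ ≤ K * ‖y‖ ^ 2 := by
  have hDg : ContDiffAt ℝ 1 (fderiv ℝ g) x₀ := hg.fderiv_right (by norm_num)
  obtain ⟨K, t, ht, hK⟩ := hDg.exists_lipschitzOnWith
  have hd : ∀ᶠ x in 𝓝 x₀, DifferentiableAt ℝ g x :=
    (hg.eventually (by simp)).mono fun x hx => hx.differentiableAt (by norm_num)
  obtain ⟨r, hr, hball⟩ := Metric.mem_nhds_iff.1 (inter_mem ht hd)
  -- Halving `r` keeps the ball of radius `‖y‖` about `x` inside `ball x₀ r`.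
  refine ⟨K, K.2, r / 2, by positivity, fun x hx y hy => ?_⟩
  have hxr : x ∈ ball x₀ r := ball_subset_ball (by linarith) hx
  have hsub : closedBall x ‖y‖ ⊆ ball x₀ r := by
    intro z hz
    rw [mem_ball] at hx ⊢
    rw [mem_closedBall] at hz
    rw [mem_ball_zero_iff] at hy
    linarith [dist_triangle z x x₀]
  have key := (convex_closedBall x ‖y‖).norm_image_sub_le_of_norm_fderiv_le' (𝕜 := ℝ) (f := g)
    (φ := fderiv ℝ g x) (C := K * ‖y‖) (x := x) (y := x + y)
    (fun z hz => (hball (hsub hz)).2)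
    (fun z hz => by
      refine (hK.norm_sub_le (hball (hsub hz)).1 (hball hxr).1).trans ?_
      gcongr
      simpa [dist_eq_norm] using hz)
    (mem_closedBall_self (norm_nonneg _)) (by simp)
  simpa [pow_two, mul_assoc] using key

/-- The bound `hC` replaces the missing second derivative of `π`: on the tangent plane at `g x` it
makes `Dπ` agree with the C¹ map `Q ∘ π` to first order. -/
theorem exists_isParametrisationFamily {g : E → F} {x₀ : E}
    (hg : ContDiffAt ℝ 2 g x₀) {π : F → E} {Q : E → F →L[ℝ] E} {C : ℝ}
    (hπ : ContDiffAt ℝ 1 π (g x₀)) (hQ : ContDiffAt ℝ 1 Q x₀)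
    (hπg : ∀ᶠ x in 𝓝 x₀, π (g x) = x)
    (hC : ∀ᶠ a in 𝓝 (g x₀), ‖fderiv ℝ π a - Q (π a)‖ ≤ C * ‖g (π a) - a‖) :
    ∃ α β : ℝ, ∃ ρ > 0,
      IsParametrisationFamily (fun x y => π (g x + fderiv ℝ g x y)) x₀ ρ α β := by
  have hDg : ContDiffAt ℝ 1 (fderiv ℝ g) x₀ := hg.fderiv_right (by norm_num)
  have hgc : Tendsto g (𝓝 x₀) (𝓝 (g x₀)) := hg.continuousAt
  set S : E → ℝ := fun x => ‖fderiv ℝ g x‖ * ‖fderiv ℝ Q x‖ with hS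
  have hSc : ContinuousAt S x₀ :=
    hDg.continuousAt.norm.mul (hQ.fderiv_right (m := 0) (by norm_num)).continuousAt.norm
  -- the pointwise properties
  have hpt : ∀ᶠ x in 𝓝 x₀, π (g x) = x ∧
      HasFDerivAt (fun y => π (g x + fderiv ℝ g x y)) (ContinuousLinearMap.id ℝ E) 0 ∧
      TwiceDifferentiableAt (fun y => π (g x + fderiv ℝ g x y)) 0 ∧
      ‖secondDeriv (fun y => π (g x + fderiv ℝ g x y)) 0‖ ≤ S x₀ + 1 := by
    have i1 : ∀ᶠ x in 𝓝 x₀, DifferentiableAt ℝ g x :=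
      (hg.eventually (by simp)).mono fun x hx => hx.differentiableAt (by norm_num)
    have i2 : ∀ᶠ x in 𝓝 x₀, ∀ᶠ a in 𝓝 (g x), DifferentiableAt ℝ π a ∧
        ‖fderiv ℝ π a - Q (π a)‖ ≤ C * ‖g (π a) - a‖ := by
      refine hgc.eventually (p := fun b => ∀ᶠ a in 𝓝 b, _) (Filter.Eventually.eventually_nhds ?_)
      exact ((hπ.eventually (by simp)).mono fun x hx => hx.differentiableAt (by norm_num)).and hC
    have i3 : ∀ᶠ x in 𝓝 x₀, DifferentiableAt ℝ Q x :=
      (hQ.eventually (by simp)).mono fun x hx => hx.differentiableAt (by norm_num)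
    have i4 : ∀ᶠ x in 𝓝 x₀, S x < S x₀ + 1 := hSc.eventually_lt_const (by linarith)
    filter_upwards [i1, i2, i3, i4, hπg.eventually_nhds] with x h1 h2 h3 h4 h5
    have hx5 : π (g x) = x := h5.self_of_nhds
    set a : E → F := fun y => g x + fderiv ℝ g x y with ha
    have ha' : ∀ y, HasFDerivAt a (fderiv ℝ g x) y := fun y =>
      (fderiv ℝ g x).hasFDerivAt.const_add _
    have ha0 : a 0 = g x := by simp [ha]
    have hac : Tendsto a (𝓝 0) (𝓝 (g x)) := by
      simpa [ha0] using (ha' 0).continuousAt.tendsto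
    have hπa : ∀ᶠ y in 𝓝 (0 : E), HasFDerivAt (fun y => π (a y))
        ((fderiv ℝ π (a y)).comp (fderiv ℝ g x)) y := by
      filter_upwards [hac.eventually h2] with y hy
      exact hy.1.hasFDerivAt.comp y (ha' y)
    have hid : (fderiv ℝ π (g x)).comp (fderiv ℝ g x) = ContinuousLinearMap.id ℝ E := by
      have e1 := (h2.self_of_nhds.1.hasFDerivAt).comp x h1.hasFDerivAt
      exact e1.unique ((hasFDerivAt_id x).congr_of_eventuallyEq h5)
    have hD0 : HasFDerivAt (fun y => π (a y)) (ContinuousLinearMap.id ℝ E) 0 := by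
      have := hπa.self_of_nhds
      rwa [ha0, hid] at this
    have hfd : fderiv ℝ (fun y => π (a y)) =ᶠ[𝓝 0]
        fun y => (fderiv ℝ π (a y)).comp (fderiv ℝ g x) := hπa.mono fun y hy => hy.fderiv
    -- the error of replacing the derivative of `π` by `Q ∘ π` is of second order
    have hg' : HasFDerivAt (fun y => g (π (a y)) - a y) (0 : E →L[ℝ] F) 0 := by
      have e1 : HasFDerivAt g (fderiv ℝ g x) (π (a 0)) := by
        rw [ha0, hx5]; exact h1.hasFDerivAt
      have e2 := (e1.comp (0 : E) hD0).fun_sub (ha' 0)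
      simpa using e2
    have hval : g (π (a 0)) - a 0 = 0 := by rw [ha0, hx5, sub_self]
    have hR : HasFDerivAt (fun y => fderiv ℝ π (a y) - Q (π (a y)))
        (0 : E →L[ℝ] F →L[ℝ] E) 0 := by
      have hR0 : fderiv ℝ π (a 0) - Q (π (a 0)) = 0 := by
        have := h2.self_of_nhds.2
        rw [hx5, sub_self, norm_zero, mul_zero] at this
        rw [ha0, hx5]
        exact norm_le_zero_iff.1 this
      rw [hasFDerivAt_iff_isLittleO_nhds_zero] at hg' ⊢
      simp only [zero_add, hval, hR0, zero_apply, sub_zero] at hg' ⊢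
      -- The residual vanishes to first order at `y = 0`, and `hC` bounds the error by a multiple of
      -- it.
      refine Asymptotics.IsBigO.trans_isLittleO ?_ hg'
      exact Asymptotics.IsBigO.of_bound C ((hac.eventually h2).mono fun y hy => hy.2)
    have hQ' : HasFDerivAt (fun y => Q (π (a y))) (fderiv ℝ Q x) 0 := by
      have e1 : HasFDerivAt Q (fderiv ℝ Q x) (π (a 0)) := by
        rw [ha0, hx5]; exact h3.hasFDerivAt
      simpa using! e1.comp (0 : E) hD0
    have hsum : HasFDerivAt (fun y => fderiv ℝ π (a y)) (fderiv ℝ Q x) 0 := by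
      simpa using hR.fun_add hQ'
    set cR : (F →L[ℝ] E) →L[ℝ] E →L[ℝ] E :=
      (ContinuousLinearMap.compL ℝ E F E).flip (fderiv ℝ g x) with hcR
    have h2d : HasFDerivAt (fderiv ℝ (fun y => π (a y))) (cR.comp (fderiv ℝ Q x)) 0 := by
      have e1 : HasFDerivAt cR cR (fderiv ℝ π (a 0)) := cR.hasFDerivAt
      have e2 : HasFDerivAt (fun y => cR (fderiv ℝ π (a y))) (cR.comp (fderiv ℝ Q x)) 0 :=
        e1.comp (0 : E) hsum
      exact e2.congr_of_eventuallyEq hfd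
    refine ⟨hx5, hD0, ⟨hπa.mono fun y hy => hy.differentiableAt, h2d.differentiableAt⟩, ?_⟩
    rw [secondDeriv, h2d.fderiv]
    refine (ContinuousLinearMap.opNorm_comp_le _ _).trans (le_trans ?_ h4.le)
    rw [hS]
    refine mul_le_mul_of_nonneg_right ?_ (norm_nonneg _)
    refine ContinuousLinearMap.opNorm_le_bound _ (norm_nonneg _) fun T => ?_
    rw [mul_comm]
    exact ContinuousLinearMap.opNorm_comp_le _ _
  -- the quadratic estimate
  obtain ⟨L, t, ht, hL⟩ := hπ.exists_lipschitzOnWith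
  obtain ⟨K, hK0, r₁, hr₁, hK⟩ := exists_norm_taylor_le hg
  have hq : ∀ᶠ z : E × E in 𝓝 (x₀, 0), π (g (z.1 + z.2)) = z.1 + z.2 ∧ g (z.1 + z.2) ∈ t ∧
      g z.1 + fderiv ℝ g z.1 z.2 ∈ t := by
    have c1 : Tendsto (fun z : E × E => z.1 + z.2) (𝓝 (x₀, 0)) (𝓝 x₀) := by
      have : Continuous fun z : E × E => z.1 + z.2 := by fun_prop
      simpa using this.tendsto (x₀, (0 : E))
    have c2 : Tendsto (fun z : E × E => g z.1 + fderiv ℝ g z.1 z.2) (𝓝 (x₀, 0)) (𝓝 (g x₀)) := by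
      have d1 : ContinuousAt (fun z : E × E => g z.1) (x₀, 0) :=
        ContinuousAt.comp (g := g) hg.continuousAt continuousAt_fst
      have d2 : ContinuousAt (fun z : E × E => fderiv ℝ g z.1) (x₀, 0) :=
        ContinuousAt.comp (g := fderiv ℝ g) hDg.continuousAt continuousAt_fst
      simpa using (d1.fun_add (d2.clm_apply continuousAt_snd)).tendsto
    exact (c1.eventually hπg).and (((hgc.comp c1).eventually ht).and (c2.eventually ht))
  obtain ⟨r₂, hr₂, hq⟩ := Metric.eventually_nhds_iff_ball.1 hq
  obtain ⟨r₃, hr₃, hpt⟩ := Metric.eventually_nhds_iff_ball.1 hpt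
  refine ⟨S x₀ + 1, L * K, min r₁ (min r₂ r₃), by positivity, ?_, ?_, ?_, ?_, ?_⟩
  · intro x hx
    simpa using (hpt x (ball_subset_ball (by simp) hx)).1
  · intro x hx
    exact (hpt x (ball_subset_ball (by simp) hx)).2.1
  · intro x hx
    exact (hpt x (ball_subset_ball (by simp) hx)).2.2.1
  · intro x hx
    exact (hpt x (ball_subset_ball (by simp) hx)).2.2.2
  · intro x hx y hy
    have hz : (x, y) ∈ ball (x₀, (0 : E)) r₂ := by
      rw [← ball_prod_same]
      exact ⟨ball_subset_ball (by simp) hx, ball_subset_ball (by simp) hy⟩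
    obtain ⟨q1, q2, q3⟩ := hq _ hz
    have hT := hK x (ball_subset_ball (by simp) hx) y (ball_subset_ball (by simp) hy)
    simp only at q1 q2 q3
    calc ‖π (g x + fderiv ℝ g x y) - x - y‖
        = ‖π (g x + fderiv ℝ g x y) - π (g (x + y))‖ := by rw [q1, sub_sub]
      _ ≤ L * ‖g x + fderiv ℝ g x y - g (x + y)‖ := hL.norm_sub_le q3 q2
      _ = L * ‖g (x + y) - g x - fderiv ℝ g x y‖ := by rw [norm_sub_rev, sub_sub]
      _ ≤ L * (K * ‖y‖ ^ 2) := by gcongr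
      _ = L * K * ‖y‖ ^ 2 := by ring

end LocalProjection

/-! ### From the embedded manifold to charts -/

section Charts

variable {n : ℕ} {M : Type*} [TopologicalSpace M] [ChartedSpace (Euc n) M]
  {W : Type*} [NormedAddCommGroup W] [NormedSpace ℝ W]

theorem contDiffAt_comp_chart_symm {c : OpenPartialHomeomorph M (Euc n)}
    (hc : c ∈ IsManifold.maximalAtlas (𝓡 n) 2 M) {f : M → W} (hf : ContMDiff (𝓡 n) 𝓘(ℝ, W) 2 f)
    {x : Euc n} (hx : x ∈ c.target) : ContDiffAt ℝ 2 (f ∘ c.symm) x := by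
  rw [← contMDiffAt_iff_contDiffAt]
  exact hf.contMDiffAt.comp x (contMDiffAt_symm_of_mem_maximalAtlas hc hx)

theorem mdifferentiable_of_mem_maximalAtlas {c : OpenPartialHomeomorph M (Euc n)}
    (hc : c ∈ IsManifold.maximalAtlas (𝓡 n) 2 M) : c.MDifferentiable (𝓡 n) (𝓡 n) :=
  ⟨(contMDiffOn_of_mem_maximalAtlas hc).mdifferentiableOn (by norm_num),
    (contMDiffOn_symm_of_mem_maximalAtlas hc).mdifferentiableOn (by norm_num)⟩

theorem fderiv_comp_chart_symm_apply {c : OpenPartialHomeomorph M (Euc n)}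
    (hc : c ∈ IsManifold.maximalAtlas (𝓡 n) 2 M) {f : M → W} (hf : ContMDiff (𝓡 n) 𝓘(ℝ, W) 2 f)
    {x : Euc n} (hx : x ∈ c.target) (y : Euc n) :
    fderiv ℝ (f ∘ c.symm) x y =
      mfderiv (𝓡 n) 𝓘(ℝ, W) f (c.symm x) (mfderiv (𝓡 n) (𝓡 n) c.symm x y) := by
  have h1 : MDifferentiableAt (𝓡 n) 𝓘(ℝ, W) f (c.symm x) :=
    hf.contMDiffAt.mdifferentiableAt (by norm_num)
  have h2 := (mdifferentiable_of_mem_maximalAtlas hc).mdifferentiableAt_symm hx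
  rw [← mfderiv_eq_fderiv, mfderiv_comp x h1 h2]
  rfl

theorem affinePoint_tangentChartInv {m : ℕ} {c : OpenPartialHomeomorph M (Euc n)}
    (hc : c ∈ IsManifold.maximalAtlas (𝓡 n) 2 M) {ι : M → Euc m}
    (hι : ContMDiff (𝓡 n) (𝓡 m) 2 ι) {x : Euc n} (hx : x ∈ c.target) (y : Euc n) :
    affinePoint ι (tangentChartInv c x y) = (ι ∘ c.symm) x + fderiv ℝ (ι ∘ c.symm) x y := by
  rw [fderiv_comp_chart_symm_apply hc hι hx]
  rfl

/-- The differential of an immersion is injective. -/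
theorem mfderiv_injective_of_isImmersionAt {m : ℕ} {ι : M → Euc m} {p : M}
    (h : Manifold.IsImmersionAt (𝓡 n) (𝓡 m) 2 ι p) :
    Function.Injective (mfderiv (𝓡 n) (𝓡 m) ι p) := by
  have hd := mdifferentiable_of_mem_maximalAtlas h.domChart_mem_maximalAtlas
  have hi := hd.mfderiv_injective h.mem_domChart_source
  have hcod := mdifferentiable_of_mem_maximalAtlas h.codChart_mem_maximalAtlas
  -- In the immersion charts `ι` is the inclusion of a factor; `P` projects back onto that factor,
  -- giving a local left inverse of `ι` up to charts.
  set P : Euc m →L[ℝ] Euc n :=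
    (ContinuousLinearMap.fst ℝ (Euc n) h.complement).comp
      (h.equiv.symm : Euc m →L[ℝ] Euc n × h.complement) with hP
  have heq : ∀ q ∈ h.domChart.source, P (h.codChart (ι q)) = h.domChart q := by
    intro q hq
    have hq' : h.domChart q ∈ (h.domChart.extend (𝓡 n)).target := by
      simpa using h.domChart.map_source hq
    have := h.writtenInCharts hq'
    simp [h.domChart.left_inv hq] at this
    rw [hP, this]
    simp
  have hev : h.domChart =ᶠ[𝓝 p] (P ∘ h.codChart) ∘ ι :=
    Filter.mem_of_superset (h.domChart.open_source.mem_nhds h.mem_domChart_source)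
      fun q hq => (heq q hq).symm
  have h1 : MDifferentiableAt (𝓡 n) (𝓡 m) ι p := h.contMDiffAt.mdifferentiableAt (by norm_num)
  have h2 : MDifferentiableAt (𝓡 m) (𝓡 n) (P ∘ h.codChart) (ι p) :=
    P.mdifferentiableAt.comp (ι p) (hcod.mdifferentiableAt h.mem_codChart_source)
  rw [hev.mfderiv_eq, mfderiv_comp p h2 h1] at hi
  exact Function.Injective.of_comp (f := mfderiv (𝓡 m) (𝓡 n) (P ∘ h.codChart) (ι p)) hi

theorem exists_chart_apply_eq_zero [IsManifold (𝓡 n) 2 M] (p : M) :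
    ∃ c ∈ IsManifold.maximalAtlas (𝓡 n) 2 M, p ∈ c.source ∧ c p = 0 := by
  set e := chartAt (Euc n) p
  have he : e ∈ IsManifold.maximalAtlas (𝓡 n) 2 M := IsManifold.chart_mem_maximalAtlas p
  refine ⟨e.trans (Homeomorph.addRight (-(e p))).toOpenPartialHomeomorph, ?_, by simp [e],
    by simp⟩
  have h1 : ContMDiff (𝓡 n) (𝓡 n) 2 (fun x : Euc n => x + -(e p)) :=
    (contDiff_id.add contDiff_const).contMDiff
  have h2 : ContMDiff (𝓡 n) (𝓡 n) 2 (fun x : Euc n => x + - -(e p)) :=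
    (contDiff_id.add contDiff_const).contMDiff
  refine OpenPartialHomeomorph.mem_maximalAtlas_of_contMDiffOn _ ?_ ?_
  · exact (h1.comp_contMDiffOn (contMDiffOn_of_mem_maximalAtlas he)).mono (by simp)
  · exact (contMDiffOn_symm_of_mem_maximalAtlas he).comp h2.contMDiffOn (by
      intro x hx; simpa using hx)

/-- In a chart, the nearest point projection onto an embedded manifold is given by any local
solution `π` of the normal equation. -/
theorem eventually_chart_eq_of_isProjectionParametrisation {m : ℕ} {ι : M → Euc m}
    (hι : ContMDiff (𝓡 n) (𝓡 m) 2 ι) (hemb : IsEmbedding ι) {φ : TangentBundle (𝓡 n) M → M}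
    (hφ : IsProjectionParametrisation ι φ) {c : OpenPartialHomeomorph M (Euc n)}
    (hc : c ∈ IsManifold.maximalAtlas (𝓡 n) 2 M) {p : M} (hp : p ∈ c.source) {π : Euc m → Euc n}
    (hπ : ∀ᶠ v in 𝓝 (ι p, c p), normalEq (ι ∘ c.symm) v = 0 ↔ π v.1 = v.2) :
    ∀ᶠ a in 𝓝 (ι p), ∀ v, affinePoint ι v = a → φ v ∈ c.source ∧ c (φ v) = π a := by
  obtain ⟨r₁, hr₁, hiff⟩ := Metric.eventually_nhds_iff_ball.1 hπ
  obtain ⟨r₂, hr₂, htar⟩ := Metric.mem_nhds_iff.1 (c.open_target.mem_nhds (c.map_source hp))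
  set r := min r₁ (r₂ / 2) with hr
  have hr0 : 0 < r := by positivity
  have hK : closedBall (c p) r ⊆ c.target :=
    (closedBall_subset_ball (by have := min_le_right r₁ (r₂ / 2); linarith)).trans htar
  have hKc : IsCompact (c.symm '' closedBall (c p) r) :=
    (isCompact_closedBall _ _).image_of_continuousOn (c.continuousOn_symm.mono hK)
  have hN : c.source ∩ c ⁻¹' ball (c p) r ∈ 𝓝 p :=
    inter_mem (c.open_source.mem_nhds hp) ((c.continuousAt hp).preimage_mem_nhds
      (ball_mem_nhds _ hr0))
  rw [hemb.nhds_eq_comap, Metric.nhds_basis_ball.comap ι |>.mem_iff] at hN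
  obtain ⟨δ, hδ, hN⟩ := hN
  -- Competitors at least as good as `p` satisfy `dist (ι q) (ι p) < δ`, so the embedding forces
  -- them into the small chart ball. A minimiser over the compact closed ball is therefore global.
  have hnear : ∀ a ∈ ball (ι p) (δ / 2), ∀ q, ‖ι q - a‖ ≤ ‖ι p - a‖ →
      q ∈ c.source ∧ c q ∈ ball (c p) r := by
    intro a ha q hq
    refine hN ?_
    rw [mem_preimage, mem_ball]
    rw [mem_ball, dist_comm] at ha
    rw [← dist_eq_norm, ← dist_eq_norm] at hq
    linarith [dist_triangle_right (ι q) (ι p) a]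
  filter_upwards [ball_mem_nhds (ι p) (half_pos hδ), ball_mem_nhds (ι p) hr₁] with a ha ha'
  rintro v rfl
  set a := affinePoint ι v
  obtain ⟨q, hqK, hqmin⟩ := hKc.exists_isMinOn ⟨p, c p, mem_closedBall_self hr0.le, c.left_inv hp⟩
    (f := fun q => ‖ι q - a‖) (by have := hι.continuous; fun_prop)
  have hpK : p ∈ c.symm '' closedBall (c p) r := ⟨c p, mem_closedBall_self hr0.le, c.left_inv hp⟩
  have hmin := hφ v ⟨q, fun s => by
    by_cases hs : ‖ι s - a‖ ≤ ‖ι p - a‖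
    · obtain ⟨h1, h2⟩ := hnear a ha s hs
      exact hqmin ⟨c s, ball_subset_closedBall h2, c.left_inv h1⟩
    · exact (hqmin hpK).trans (not_le.1 hs).le⟩
  obtain ⟨h1, h2⟩ := hnear a ha (φ v) (hmin p)
  refine ⟨h1, ?_⟩
  set z := c (φ v) with hz
  have hzt : z ∈ c.target := c.map_source h1
  have hza : (a, z) ∈ ball (ι p, c p) r₁ := by
    rw [← ball_prod_same]
    exact ⟨ha', ball_subset_ball (min_le_left _ _) h2⟩
  refine ((hiff _ hza).1 ?_).symm
  have hd : HasFDerivAt (ι ∘ c.symm) (fderiv ℝ (ι ∘ c.symm) z) z :=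
    ((contDiffAt_comp_chart_symm hc hι hzt).differentiableAt (by norm_num)).hasFDerivAt
  -- The derivative of the squared distance is twice `normalEq`, so Fermat's rule yields the normal
  -- equation.
  have hloc : IsLocalMin (fun w => ‖(ι ∘ c.symm) w - a‖ ^ 2) z := by
    refine Filter.Eventually.of_forall fun w => ?_
    have h3 : (ι ∘ c.symm) z = ι (φ v) := by simp [hz, c.left_inv h1]
    simp only [h3]
    gcongr
    exact hmin _
  have h0 := hloc.hasFDerivAt_eq_zero (hd.sub_const a).norm_sq
  ext η
  have h4 := congrArg (fun T : Euc n →L[ℝ] ℝ => T η) h0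
  simpa [normalEq] using h4

/-- In any chart of an embedded manifold, the projection is locally a parametrisation family. -/
theorem exists_localRep_isParametrisationFamily {m : ℕ} {ι : M → Euc m}
    (hι : Manifold.IsSmoothEmbedding (𝓡 n) (𝓡 m) 2 ι) {φ : TangentBundle (𝓡 n) M → M}
    (hφ : IsProjectionParametrisation ι φ) {c : OpenPartialHomeomorph M (Euc n)}
    (hc : c ∈ IsManifold.maximalAtlas (𝓡 n) 2 M) {p : M} (hp : p ∈ c.source) :
    ∃ h : Euc n → Euc n → Euc n, ∃ α β : ℝ, ∃ ρ > 0, IsParametrisationFamily h (c p) ρ α β ∧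
      ∀ x ∈ ball (c p) ρ, ∀ y ∈ ball (0 : Euc n) ρ,
        (x, y) ∈ localDom c φ ∧ localRep c φ x y = h x y := by
  have hs := hι.contMDiff
  have hpt : c p ∈ c.target := c.map_source hp
  have hgp : (ι ∘ c.symm) (c p) = ι p := by simp [c.left_inv hp]
  have hg := contDiffAt_comp_chart_symm hc hs hpt
  have hinj : Function.Injective (fderiv ℝ (ι ∘ c.symm) (c p)) := by
    have h1 := mfderiv_injective_of_isImmersionAt (hι.isImmersion.isImmersionAt (c.symm (c p)))
    have h2 := (mdifferentiable_of_mem_maximalAtlas hc).symm.mfderiv_injective hpt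
    have h3 : ⇑(fderiv ℝ (ι ∘ c.symm) (c p)) = mfderiv (𝓡 n) (𝓡 m) ι (c.symm (c p)) ∘
        mfderiv (𝓡 n) (𝓡 n) c.symm (c p) := funext fun y => fderiv_comp_chart_symm_apply hc hs hpt y
    rw [h3]
    exact h1.comp h2
  obtain ⟨π, Q, C, hπ, hQ, hiff, hC⟩ := exists_projection hg hinj
  have hπg : ∀ᶠ x in 𝓝 (c p), π ((ι ∘ c.symm) x) = x := by
    have : Tendsto (fun x => ((ι ∘ c.symm) x, x)) (𝓝 (c p)) (𝓝 ((ι ∘ c.symm) (c p), c p)) :=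
      hg.continuousAt.prodMk continuousAt_id
    filter_upwards [this.eventually hiff] with x hx
    exact hx.1 (normalEq_self _ _)
  obtain ⟨α, β, ρ₁, hρ₁, hfam⟩ := exists_isParametrisationFamily hg hπ hQ hπg hC
  have hnear := eventually_chart_eq_of_isProjectionParametrisation hs hι.isEmbedding hφ hc hp
    (hgp ▸ hiff)
  have hcont : Tendsto (fun z : Euc n × Euc n => (ι ∘ c.symm) z.1 + fderiv ℝ (ι ∘ c.symm) z.1 z.2)
      (𝓝 (c p, 0)) (𝓝 (ι p)) := by
    have d1 : ContinuousAt (fun z : Euc n × Euc n => (ι ∘ c.symm) z.1) (c p, 0) :=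
      ContinuousAt.comp (g := ι ∘ c.symm) hg.continuousAt continuousAt_fst
    have d2 : ContinuousAt (fun z : Euc n × Euc n => fderiv ℝ (ι ∘ c.symm) z.1) (c p, 0) :=
      ContinuousAt.comp (g := fderiv ℝ (ι ∘ c.symm))
        (hg.fderiv_right (m := 1) (by norm_num)).continuousAt continuousAt_fst
    simpa [c.left_inv hp] using (d1.fun_add (d2.clm_apply continuousAt_snd)).tendsto
  obtain ⟨ρ₂, hρ₂, hev⟩ := Metric.eventually_nhds_iff_ball.1 ((hcont.eventually hnear).and
    (continuousAt_fst.eventually (c.open_target.mem_nhds hpt)))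
  refine ⟨fun x y => π ((ι ∘ c.symm) x + fderiv ℝ (ι ∘ c.symm) x y), α, β, min ρ₁ ρ₂,
    by positivity, hfam.mono (min_le_left _ _), fun x hx y hy => ?_⟩
  have hz : (x, y) ∈ ball (c p, (0 : Euc n)) ρ₂ := by
    rw [← ball_prod_same]
    exact ⟨ball_subset_ball (min_le_right _ _) hx, ball_subset_ball (min_le_right _ _) hy⟩
  obtain ⟨h1, h2⟩ := hev _ hz
  obtain ⟨h3, h4⟩ := h1 (tangentChartInv c x y) (affinePoint_tangentChartInv hc hs h2 y)
  exact ⟨⟨h2, h3⟩, h4⟩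

end Charts

/-! ### Newton's method in coordinates -/

section Newton

set_option maxSynthPendingDepth 3

variable {V W : Type*} [NormedAddCommGroup V] [NormedSpace ℝ V]
  [NormedAddCommGroup W] [NormedSpace ℝ W]

theorem secondDeriv_congr {g g' : V → W} {x : V} (h : g =ᶠ[𝓝 x] g') :
    secondDeriv g x = secondDeriv g' x :=
  h.fderiv.fderiv_eq

theorem TwiceDifferentiableAt.congr {g g' : V → W} {x : V} (hg : TwiceDifferentiableAt g x)
    (h : g' =ᶠ[𝓝 x] g) : TwiceDifferentiableAt g' x := by
  refine ⟨?_, hg.2.congr_of_eventuallyEq h.fderiv⟩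
  filter_upwards [hg.1, h.eventuallyEq_nhds] with y hy hy'
  exact hy.congr_of_eventuallyEq hy'

theorem NewtonDefinedAt.congr {g g' : V → ℝ} {x : V} (hg : NewtonDefinedAt g x)
    (h : g' =ᶠ[𝓝 x] g) : NewtonDefinedAt g' x :=
  ⟨hg.1.congr h, by rw [secondDeriv_congr h]; exact hg.2⟩

theorem newtonStep_congr {g g' : V → ℝ} {x : V} (h : g' =ᶠ[𝓝 x] g) :
    newtonStep g' x = newtonStep g x := by
  rw [newtonStep, newtonStep, secondDeriv_congr h, h.fderiv_eq]

/-- The Newton step is invariant under linear changes of coordinates. -/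
theorem NewtonDefinedAt.of_comp_equiv {G : W → ℝ} (L : V ≃L[ℝ] W)
    (h : NewtonDefinedAt (G ∘ L) 0) :
    NewtonDefinedAt G 0 ∧ newtonStep G 0 = L (newtonStep (G ∘ L) 0) := by
  have hG : ∀ w, fderiv ℝ G w = (fderiv ℝ (G ∘ L) (L.symm w)).comp (L.symm : W →L[ℝ] V) := by
    intro w
    rw [L.comp_right_fderiv]
    ext; simp
  set T : (V →L[ℝ] ℝ) ≃L[ℝ] (W →L[ℝ] ℝ) := L.arrowCongr (ContinuousLinearEquiv.refl ℝ ℝ) with hT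
  have hGT : fderiv ℝ G = fun w => T (fderiv ℝ (G ∘ L) (L.symm w)) := by
    funext w
    rw [hG]
    ext; simp [hT]
  obtain ⟨⟨h1, h2⟩, e, he⟩ := h
  have h2' : HasFDerivAt (fderiv ℝ (G ∘ L)) (e : V →L[ℝ] V →L[ℝ] ℝ) (L.symm 0) := by
    rw [he, map_zero]
    exact h2.hasFDerivAt
  have hd : HasFDerivAt (fderiv ℝ G)
      ((L.symm.trans (e.trans T) : W ≃L[ℝ] (W →L[ℝ] ℝ)) : W →L[ℝ] W →L[ℝ] ℝ) 0 := by
    rw [hGT]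
    exact T.hasFDerivAt.comp (0 : W) (h2'.comp (0 : W) L.symm.hasFDerivAt)
  refine ⟨⟨⟨?_, hd.differentiableAt⟩, ?_⟩, ?_⟩
  · have : Tendsto L.symm (𝓝 0) (𝓝 0) := by
      simpa using L.symm.continuous.tendsto 0
    filter_upwards [this.eventually h1] with w hw
    have := hw.comp w L.symm.differentiableAt
    simpa [Function.comp_def] using this
  · rw [secondDeriv, hd.fderiv]
    exact ⟨_, rfl⟩
  · rw [newtonStep, newtonStep, secondDeriv, hd.fderiv, ← he, ContinuousLinearMap.inverse_equiv,
      ContinuousLinearMap.inverse_equiv, hGT]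
    simp

/-- The second order chain rule at a point where the inner map is tangent to a translation. -/
theorem hasFDerivAt_fderiv_comp {F : V → ℝ} {k : V → V} {x : V} (hF : ContDiffAt ℝ 2 F x)
    (hk0 : k 0 = x) (hk1 : HasFDerivAt k (ContinuousLinearMap.id ℝ V) 0)
    (hk2 : TwiceDifferentiableAt k 0) :
    fderiv ℝ (F ∘ k) 0 = fderiv ℝ F x ∧ (∀ᶠ y in 𝓝 0, DifferentiableAt ℝ (F ∘ k) y) ∧
    HasFDerivAt (fderiv ℝ (F ∘ k)) (secondDeriv F x +
      (ContinuousLinearMap.compL ℝ V V ℝ (fderiv ℝ F x)).comp (secondDeriv k 0)) 0 := by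
  have hkc : Tendsto k (𝓝 0) (𝓝 x) := by simpa [hk0] using hk1.continuousAt.tendsto
  have hev : ∀ᶠ y in 𝓝 0, HasFDerivAt (F ∘ k) ((fderiv ℝ F (k y)).comp (fderiv ℝ k y)) y := by
    filter_upwards [hk2.1, hkc.eventually (hF.eventually (by simp))] with y h1 h2
    exact (h2.differentiableAt (by norm_num)).hasFDerivAt.comp y h1.hasFDerivAt
  have hD : HasFDerivAt (fderiv ℝ F) (secondDeriv F x) (k 0) := by
    rw [hk0]
    exact ((hF.fderiv_right (m := 1) (by norm_num)).differentiableAt (by norm_num)).hasFDerivAt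
  refine ⟨?_, hev.mono fun y hy => hy.differentiableAt, ?_⟩
  · rw [hev.self_of_nhds.fderiv, hk1.fderiv, hk0]
    exact ContinuousLinearMap.comp_id _
  · have h1 : HasFDerivAt (fun y => fderiv ℝ F (k y)) (secondDeriv F x) 0 := by
      simpa using! hD.comp (0 : V) hk1
    have h2 := h1.clm_comp hk2.2.hasFDerivAt
    refine (h2.congr_of_eventuallyEq (hev.mono fun y hy => hy.fderiv)).congr_fderiv ?_
    rw [hk1.fderiv, hk0, add_comm]
    congr 1

/-- The hypothesis controls the Hessian at `x` only in the direction `x`, which suffices for the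
mean value inequality along the segment from `0` to `x`. -/
theorem eventually_norm_fderiv_sub_secondDeriv_le {F : V → ℝ} (hF : ContDiffAt ℝ 2 F 0)
    (hcrit : fderiv ℝ F 0 = 0) {η : ℝ} (hη0 : 0 ≤ η)
    (hη : ∀ᶠ x in 𝓝 0, ‖(secondDeriv F x - secondDeriv F 0) x‖ ≤ η * ‖x‖ ^ 2) :
    ∀ᶠ x in 𝓝 0, ‖fderiv ℝ F x - secondDeriv F 0 x‖ ≤ η * ‖x‖ ^ 2 := by
  have hd : ∀ᶠ x in 𝓝 0, DifferentiableAt ℝ (fderiv ℝ F) x :=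
    (hF.eventually (by simp)).mono fun x hx =>
      (hx.fderiv_right (m := 1) (by norm_num)).differentiableAt (by norm_num)
  obtain ⟨r, hr, hball⟩ := Metric.eventually_nhds_iff_ball.1 (hη.and hd)
  filter_upwards [ball_mem_nhds (0 : V) hr] with x hx
  have hmem : ∀ t ∈ Icc (0 : ℝ) 1, t • x ∈ ball (0 : V) r := by
    intro t ht
    rw [mem_ball_zero_iff] at hx ⊢
    rw [norm_smul, Real.norm_of_nonneg ht.1]
    exact (mul_le_of_le_one_left (norm_nonneg _) ht.2).trans_lt hx
  have key := norm_image_sub_le_of_norm_deriv_le_segment_01'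
    (f := fun t : ℝ => fderiv ℝ F (t • x) - t • secondDeriv F 0 x)
    (f' := fun t => (secondDeriv F (t • x) - secondDeriv F 0) x) (C := η * ‖x‖ ^ 2) ?_ ?_
  · simpa [hcrit] using key
  · intro t ht
    have h1 : HasDerivAt (fun t : ℝ => t • x) x t := by
      simpa using (hasDerivAt_id t).smul_const x
    have h2 : HasDerivAt (fun t : ℝ => t • secondDeriv F 0 x) (secondDeriv F 0 x) t := by
      simpa using (hasDerivAt_id t).smul_const (secondDeriv F 0 x)
    exact (((hball _ (hmem t ht)).2.hasFDerivAt.comp_hasDerivAt t h1).sub h2).hasDerivWithinAt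
  · intro t ht
    -- The hypothesis at `t • x` carries a factor `t` on the left, cancelled when `t > 0`; at `t =
    -- 0` the difference of Hessians is zero.
    rcases ht.1.eq_or_lt with rfl | ht0
    · simp; positivity
    · have h1 := (hball _ (hmem t ⟨ht.1, ht.2.le⟩)).1
      rw [map_smul, norm_smul, norm_smul, Real.norm_of_nonneg ht.1, mul_pow] at h1
      have h2 : t * ‖(secondDeriv F (t • x) - secondDeriv F 0) x‖ ≤ t * (η * ‖x‖ ^ 2) := by
        refine h1.trans ?_
        have : t ^ 2 ≤ t := by nlinarith [ht.2]
        nlinarith [mul_nonneg hη0 (sq_nonneg ‖x‖)]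
      exact le_of_mul_le_mul_left h2 ht0

set_option maxHeartbeats 1000000 in
/-- Local quadratic convergence of the generalised Newton iteration in coordinates. -/
theorem exists_newton_quadratic_bound [CompleteSpace V] {F : V → ℝ} {h : V → V → V}
    {ρ α β η : ℝ} (hF : ContDiffAt ℝ 2 F 0) (hcrit : fderiv ℝ F 0 = 0)
    (hinv : (secondDeriv F 0).IsInvertible) (hη0 : 0 ≤ η)
    (hη : ∀ᶠ x in 𝓝 0, ‖(secondDeriv F x - secondDeriv F 0) x‖ ≤ η * ‖x‖ ^ 2)
    (hρ : 0 < ρ) (hfam : IsParametrisationFamily h 0 ρ α β) :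
    ∃ κ : ℝ, ∃ r > 0, r ≤ ρ ∧ ∀ x ∈ ball (0 : V) r, NewtonDefinedAt (F ∘ h x) 0 ∧
      newtonStep (F ∘ h x) 0 ∈ ball (0 : V) ρ ∧
      h x (newtonStep (F ∘ h x) 0) ∈ ball (0 : V) r ∧
      ‖h x (newtonStep (F ∘ h x) 0)‖ ≤ κ * ‖x‖ ^ 2 := by
  have hDF : ContDiffAt ℝ 1 (fderiv ℝ F) 0 := hF.fderiv_right (by norm_num)
  have hD2c : ContinuousAt (secondDeriv F) 0 :=
    (hDF.fderiv_right (m := 0) (by norm_num)).continuousAt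
  have hα : 0 ≤ α := (norm_nonneg _).trans (hfam.norm_secondDeriv_le 0 (mem_ball_self hρ))
  set J : V → V →L[ℝ] V →L[ℝ] ℝ := fun x => secondDeriv F x +
    (ContinuousLinearMap.compL ℝ V V ℝ (fderiv ℝ F x)).comp (secondDeriv (h x) 0) with hJ
  have hcorr : ∀ x ∈ ball (0 : V) ρ,
      ‖(ContinuousLinearMap.compL ℝ V V ℝ (fderiv ℝ F x)).comp (secondDeriv (h x) 0)‖ ≤
        ‖fderiv ℝ F x‖ * α := by
    intro x hx
    refine (ContinuousLinearMap.opNorm_comp_le _ _).trans ?_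
    gcongr
    · exact ContinuousLinearMap.opNorm_le_bound _ (norm_nonneg _)
        fun T => ContinuousLinearMap.opNorm_comp_le _ _
    · exact hfam.norm_secondDeriv_le x hx
  have hJc : Tendsto J (𝓝 0) (𝓝 (secondDeriv F 0)) := by
    have h0 : Tendsto (fun x => ‖fderiv ℝ F x‖ * α) (𝓝 0) (𝓝 0) := by
      simpa [hcrit] using (hDF.continuousAt.norm.tendsto.mul_const α)
    have h1 := squeeze_zero_norm' (f := fun x =>
      (ContinuousLinearMap.compL ℝ V V ℝ (fderiv ℝ F x)).comp (secondDeriv (h x) 0))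
      (mem_of_superset (ball_mem_nhds (0 : V) hρ) hcorr) h0
    simpa using hD2c.tendsto.add h1
  obtain ⟨K, t, ht, hK⟩ := hDF.exists_lipschitzOnWith
  have hKx : ∀ᶠ x in 𝓝 0, ‖fderiv ℝ F x‖ ≤ K * ‖x‖ := by
    filter_upwards [ht] with x hx
    simpa [hcrit] using hK.norm_sub_le hx (mem_of_mem_nhds ht)
  set B : ℝ := ‖(secondDeriv F 0).inverse‖ + 1 with hB
  have hB0 : 0 ≤ B := by positivity
  have hJB : ∀ᶠ x in 𝓝 0, ‖(J x).inverse‖ < B :=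
    ((hinv.contDiffAt_map_inverse (n := 0)).continuousAt.tendsto.comp hJc).norm.eventually_lt_const
      (by rw [hB]; linarith)
  have hJinv : ∀ᶠ x in 𝓝 0, (J x).IsInvertible := by
    obtain ⟨e, he⟩ := hinv
    have := ContinuousLinearEquiv.nhds e
    rw [he] at this
    filter_upwards [hJc this] with x hx
    exact hx
  -- The first term is the C2 error at a step of length at most `B * K * ‖x‖`; the second bounds `x
  -- + N`.
  set κ : ℝ := |β| * (B * K) ^ 2 + B * (2 * η + K * α) with hκ
  have hκ0 : 0 ≤ κ := by positivity
  obtain ⟨r₀, hr₀, hball⟩ := Metric.eventually_nhds_iff_ball.1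
    ((((hη.and (eventually_norm_fderiv_sub_secondDeriv_le hF hcrit hη0 hη)).and hKx).and
      (hJB.and hJinv)).and (hF.eventually (by simp)))
  -- The third bound keeps the step in `ball 0 ρ`; the last gives `κ * ‖x‖ ≤ 1`, so the ball is
  -- mapped to itself.
  set r := min (min r₀ ρ) (min (ρ / (B * K + 1)) (1 / (κ + 1))) with hr
  have hBK : (0 : ℝ) ≤ B * K := by positivity
  have hrpos : 0 < r := by positivity
  have hrρ : r ≤ ρ := (min_le_left _ _).trans (min_le_right _ _)
  refine ⟨κ, r, hrpos, hrρ, fun x hx => ?_⟩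
  have hxρ : x ∈ ball (0 : V) ρ := ball_subset_ball hrρ hx
  obtain ⟨⟨⟨⟨a1, a2⟩, a3⟩, a4, a5⟩, a6⟩ :=
    hball x (ball_subset_ball ((min_le_left _ _).trans (min_le_left _ _)) hx)
  obtain ⟨b1, b2, b3⟩ := hasFDerivAt_fderiv_comp a6 (hfam.apply_zero x hxρ)
    (hfam.hasFDerivAt x hxρ) (hfam.twiceDifferentiableAt x hxρ)
  have hsd : secondDeriv (F ∘ h x) 0 = J x := b3.fderiv
  set N := newtonStep (F ∘ h x) 0 with hN
  have hNeq : N = -(J x).inverse (fderiv ℝ F x) := by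
    rw [hN, newtonStep, hsd, b1, zero_sub]
  have hxr : ‖x‖ < r := mem_ball_zero_iff.1 hx
  have hNle : ‖N‖ ≤ B * K * ‖x‖ := by
    rw [hNeq, norm_neg, mul_assoc]
    exact (ContinuousLinearMap.le_opNorm _ _).trans (by gcongr)
  have hNρ : ‖N‖ < ρ := by
    have h1 : r ≤ ρ / (B * K + 1) := (min_le_right _ _).trans (min_le_left _ _)
    rw [le_div_iff₀ (by positivity)] at h1
    nlinarith [norm_nonneg x]
  have hxN : ‖x + N‖ ≤ B * (2 * η + K * α) * ‖x‖ ^ 2 := by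
    have e1 : x + N = (J x).inverse (J x x - fderiv ℝ F x) := by
      obtain ⟨e, he⟩ := a5
      rw [hNeq, map_sub, ← he]
      simp [sub_eq_add_neg]
    -- Each of the three terms is `O(‖x‖²)`: the first two contribute `η` each, the last `K * α`.
    have e2 : J x x - fderiv ℝ F x = (secondDeriv F x - secondDeriv F 0) x -
        (fderiv ℝ F x - secondDeriv F 0 x) +
        ((ContinuousLinearMap.compL ℝ V V ℝ (fderiv ℝ F x)).comp (secondDeriv (h x) 0)) x := by
      simp only [hJ, add_apply, sub_apply]
      abel
    have e3 : ‖J x x - fderiv ℝ F x‖ ≤ (2 * η + K * α) * ‖x‖ ^ 2 := by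
      rw [e2]
      have e4 : ‖((ContinuousLinearMap.compL ℝ V V ℝ (fderiv ℝ F x)).comp
          (secondDeriv (h x) 0)) x‖ ≤ K * ‖x‖ * α * ‖x‖ :=
        (ContinuousLinearMap.le_opNorm _ _).trans (by
          refine mul_le_mul_of_nonneg_right ((hcorr x hxρ).trans ?_) (norm_nonneg _)
          gcongr)
      refine (norm_add_le _ _).trans ((add_le_add (norm_sub_le _ _) e4).trans ?_)
      linarith
    rw [e1, mul_assoc]
    exact (ContinuousLinearMap.le_opNorm _ _).trans (by gcongr)
  have hbound : ‖h x N‖ ≤ κ * ‖x‖ ^ 2 := by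
    have e1 : h x N = (h x N - x - N) + (x + N) := by abel
    have e2 : ‖h x N - x - N‖ ≤ |β| * (B * K * ‖x‖) ^ 2 :=
      (hfam.norm_sub_le x hxρ N (mem_ball_zero_iff.2 hNρ)).trans (by
        gcongr
        exact le_abs_self β)
    rw [e1]
    refine (norm_add_le _ _).trans ((add_le_add e2 hxN).trans (le_of_eq ?_))
    rw [hκ]; ring
  refine ⟨⟨⟨b2, b3.differentiableAt⟩, hsd ▸ a5⟩, mem_ball_zero_iff.2 hNρ, ?_, hbound⟩
  rw [mem_ball_zero_iff]
  have h1 : r ≤ 1 / (κ + 1) := (min_le_right _ _).trans (min_le_right _ _)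
  rw [le_div_iff₀ (by positivity)] at h1
  have h2 : κ * ‖x‖ ≤ 1 := by nlinarith
  nlinarith [norm_nonneg x]

end Newton

/-! ### C1, C2 and convergence on the manifold -/

section Convergence

variable {n : ℕ} {M : Type*} [TopologicalSpace M] [ChartedSpace (Euc n) M]

theorem localRep_eventuallyEq {c : OpenPartialHomeomorph M (Euc n)}
    {φ : TangentBundle (𝓡 n) M → M} {h : Euc n → Euc n → Euc n} {x₀ : Euc n} {ρ : ℝ} (hρ : 0 < ρ)
    (hrep : ∀ x ∈ ball x₀ ρ, ∀ y ∈ ball (0 : Euc n) ρ,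
      (x, y) ∈ localDom c φ ∧ localRep c φ x y = h x y) {x : Euc n} (hx : x ∈ ball x₀ ρ) :
    localRep c φ x =ᶠ[𝓝 0] h x :=
  mem_of_superset (ball_mem_nhds (0 : Euc n) hρ) fun y hy => (hrep x hx y hy).2

theorem satisfiesC1C2_of_isProjectionParametrisation [IsManifold (𝓡 n) 2 M] {m : ℕ}
    {ι : M → Euc m} (hι : Manifold.IsSmoothEmbedding (𝓡 n) (𝓡 m) 2 ι)
    {φ : TangentBundle (𝓡 n) M → M} (hφ : IsProjectionParametrisation ι φ) :
    SatisfiesC1C2 φ φ := by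
  intro p
  obtain ⟨c, hc, hp, hcp⟩ := exists_chart_apply_eq_zero (n := n) p
  obtain ⟨h, α, β, ρ, hρ, hfam, hrep⟩ := exists_localRep_isParametrisationFamily hι hφ hc hp
  rw [hcp] at hfam hrep
  have hdom : ∀ x ∈ ball (0 : Euc n) ρ, ∀ᶠ y in 𝓝 (0 : Euc n), (x, y) ∈ localDom c φ :=
    fun x hx => mem_of_superset (ball_mem_nhds (0 : Euc n) hρ) fun y hy => (hrep x hx y hy).1
  have heq := fun x (hx : x ∈ ball (0 : Euc n) ρ) => localRep_eventuallyEq hρ hrep hx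
  refine ⟨c, hc, hp, hcp, ρ, hρ, ⟨fun x hx => ⟨hdom x hx, ?_, ?_⟩, α, fun x hx =>
    ⟨hdom x hx, ?_, fun ξ hξ => ?_⟩⟩, β, fun x hx y hy => ⟨(hrep x hx y hy).1, ?_⟩⟩
  · rw [(hrep x hx 0 (mem_ball_self hρ)).2, hfam.apply_zero x hx]
  · exact (hfam.hasFDerivAt x hx).congr_of_eventuallyEq (heq x hx)
  · exact (hfam.twiceDifferentiableAt x hx).congr (heq x hx)
  · rw [secondDeriv_congr (heq x hx)]
    have h1 := (secondDeriv (h x) 0).le_opNorm₂ ξ ξ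
    rw [hξ, mul_one, mul_one] at h1
    exact h1.trans (hfam.norm_secondDeriv_le x hx)
  · rw [(hrep x hx y hy).2]
    exact hfam.norm_sub_le x hx y hy

theorem convergesLocallyQuadratically_newtonIteration {m : ℕ}
    {ι : M → Euc m} (hι : Manifold.IsSmoothEmbedding (𝓡 n) (𝓡 m) 2 ι)
    {φ : TangentBundle (𝓡 n) M → M} (hφ : IsProjectionParametrisation ι φ)
    {f : M → ℝ} (hf : ContMDiff (𝓡 n) 𝓘(ℝ, ℝ) 2 f) {p : M} {c : OpenPartialHomeomorph M (Euc n)}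
    (hc : c ∈ IsManifold.maximalAtlas (𝓡 n) 2 M) (hp : p ∈ c.source) (hcp : c p = 0)
    (hcrit : IsNondegenerateCriticalPoint c f p) {η : ℝ} (hη0 : 0 ≤ η)
    (hη : ∀ x ∈ c.target,
      ‖(secondDeriv (f ∘ c.symm) x - secondDeriv (f ∘ c.symm) 0) x‖ ≤ η * ‖x‖ ^ 2) :
    ConvergesLocallyQuadratically (n := n) (newtonDom φ f) (newtonIteration φ φ f) p := by
  obtain ⟨h, α, β, ρ, hρ, hfam, hrep⟩ := exists_localRep_isParametrisationFamily hι hφ hc hp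
  rw [hcp] at hfam hrep
  obtain ⟨hD, hH⟩ := hcrit
  have h0t : (0 : Euc n) ∈ c.target := hcp ▸ c.map_source hp
  have h0p : c.symm 0 = p := by rw [← hcp, c.left_inv hp]
  rw [hcp] at hH
  have hD0 : fderiv ℝ (f ∘ c.symm) 0 = 0 := by
    ext1 y
    rw [fderiv_comp_chart_symm_apply hc hf h0t, h0p, hD]
    rfl
  obtain ⟨κ, r, hr, hrρ, hN⟩ := exists_newton_quadratic_bound
    (contDiffAt_comp_chart_symm hc hf h0t) hD0 hH hη0
    (mem_of_superset (c.open_target.mem_nhds h0t) hη) hρ hfam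
  refine ⟨c, hc, hp, κ, ball 0 r, isOpen_ball, hcp ▸ mem_ball_self hr, fun x hx => ?_⟩
  have hxρ := ball_subset_ball hrρ hx
  obtain ⟨n1, n2, n3, n4⟩ := hN x hx
  have hxt : x ∈ c.target := (hrep x hxρ 0 (mem_ball_self hρ)).1.1
  -- `fibreMap` uses the preferred chart at the base point, `localRep` the frame of `c`; `L` passes
  -- between them, and the Newton step commutes with it.
  set L : Euc n ≃L[ℝ] Euc n := (mdifferentiable_of_mem_maximalAtlas hc).symm.mfderiv hxt with hL
  have hLφ : ∀ y, fibreMap φ (c.symm x) (L y) = φ (tangentChartInv c x y) := fun y => rfl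
  have hev : (f ∘ fibreMap φ (c.symm x)) ∘ L =ᶠ[𝓝 0] (f ∘ c.symm) ∘ h x := by
    filter_upwards [ball_mem_nhds (0 : Euc n) hρ] with y hy
    obtain ⟨⟨_, h1⟩, h2⟩ := hrep x hxρ y hy
    simp only [Function.comp_apply, hLφ, ← h2, localRep]
    rw [c.left_inv h1]
  obtain ⟨d1, d2⟩ := (n1.congr hev).of_comp_equiv L
  rw [newtonStep_congr hev] at d2
  have hE : newtonIteration φ φ f (c.symm x) =
      φ (tangentChartInv c x (newtonStep ((f ∘ c.symm) ∘ h x) 0)) := by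
    rw [newtonIteration, d2, hLφ]
  obtain ⟨⟨_, h1⟩, h2⟩ := hrep x hxρ _ n2
  have h3 : c (newtonIteration φ φ f (c.symm x)) = h x (newtonStep ((f ∘ c.symm) ∘ h x) 0) := by
    rw [hE, ← h2, localRep]
  refine ⟨⟨hxt, d1, hE ▸ h1⟩, h3 ▸ n3, ?_⟩
  rw [h3, hcp, sub_zero, sub_zero]
  exact n4

end Convergence

end NewtonMfd

end

open NewtonMfd in
theorem proposition17 (n k : ℕ) {M : Type*} [TopologicalSpace M] [ChartedSpace (Euc n) M]
    [IsManifold (𝓡 n) 2 M] (ι : M → Euc (n + k))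
    (hι : Manifold.IsSmoothEmbedding (𝓡 n) (𝓡 (n + k)) 2 ι)
    (φ : TangentBundle (𝓡 n) M → M) (hφ : IsProjectionParametrisation ι φ) :
    SatisfiesC1C2 φ φ ∧
    ∀ f : M → ℝ, ContMDiff (𝓡 n) 𝓘(ℝ, ℝ) 2 f →
      ∀ p : M, ∀ c ∈ IsManifold.maximalAtlas (𝓡 n) 2 M, p ∈ c.source → c p = 0 →
        IsNondegenerateCriticalPoint c f p →
        (∃ η > 0, ∀ x ∈ c.target,
          ‖(secondDeriv (f ∘ c.symm) x - secondDeriv (f ∘ c.symm) 0) x‖ ≤ η * ‖x‖ ^ 2) →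
        ConvergesLocallyQuadratically (n := n) (newtonDom φ f) (newtonIteration φ φ f) p := by
  refine ⟨satisfiesC1C2_of_isProjectionParametrisation hι hφ, ?_⟩
  rintro f hf p c hc hp hcp hcrit ⟨η, hη0, hη⟩
  exact convergesLocallyQuadratically_newtonIteration hι hφ hf hc hp hcp hcrit hη0.le hη
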